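/- Let $R$ be a non-degenerate axis-aligned rectangle whose long sides are vertical, with long side $l$, short side $s$ and aspect ratio $A = l/s \ge 1$. Let $P$ be a finite set of points in the plane in general position with respect to $R$: no four points of $P$ lie on the boundary of any scaled translate (homothet) of $R$, and no two points of $P$ lie on a common vertical or horizontal line. The rectangle Delaunay triangulation of $P$ is the geometric graph with vertex set $P$ in which two distinct vertices are adjacent if and only if there is a scaled translate of $R$ that has both of them on its boundary and has no point of $P$ in its interior; each edge is weighted by its Euclidean length. For $u, v \in P$ let $d_t(u,v)$ be the length of a shortest path from $u$ to $v$ in this graph ($\infty$ if there is none), and let $d_x(u,v)$ and $d_y(u,v)$ be the absolute differences of the $x$-coordinates and of the $y$-coordinates of $u$ and $v$. Then for any two vertices $u, v \in P$, writing $x = d_x(u,v)$ and $y = d_y(u,v)$: if $A x \ge y$, then $$d_t(u,v) \le \left(A + \sqrt{A^2+1}\right) x + y,$$ and otherwise $$d_t(u,v) \le A x + \left(1 + \sqrt{\tfrac{1}{A^2}+1}\right) y.$$ -/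

import Mathlib

open scoped ENNReal

/-- The Euclidean plane; coordinate `0` is `x`, coordinate `1` is `y`. -/
abbrev Plane : Type := EuclideanSpace ℝ (Fin 2)

/-- The difference in `x`-coordinate between two points. -/
def dx (p q : Plane) : ℝ := |p 0 - q 0|

/-- The difference in `y`-coordinate between two points. -/
def dy (p q : Plane) : ℝ := |p 1 - q 1|

/-- A non-degenerate axis-aligned rectangle
`[left, left + width] × [bottom, bottom + height]`. -/
structure Rectangle where
  left : ℝ
  bottom : ℝ
  width : ℝ
  height : ℝ
  width_pos : 0 < width
  height_pos : 0 < height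

namespace Rectangle

/-- The closed rectangle as a set of points. -/
def carrier (R : Rectangle) : Set Plane :=
  {p | R.left ≤ p 0 ∧ p 0 ≤ R.left + R.width ∧ R.bottom ≤ p 1 ∧ p 1 ≤ R.bottom + R.height}

/-- The interior of the rectangle. -/
def inner (R : Rectangle) : Set Plane :=
  {p | R.left < p 0 ∧ p 0 < R.left + R.width ∧ R.bottom < p 1 ∧ p 1 < R.bottom + R.height}

/-- The boundary of the rectangle: the union of its four closed sides. -/
def boundary (R : Rectangle) : Set Plane := R.carrier \ R.inner

/-- `S.IsHomothetOf R`: the rectangle `S` is a scaled translate of `R`. The translation is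
arbitrary, so only the side lengths of `S` are constrained. -/
def IsHomothetOf (S R : Rectangle) : Prop :=
  ∃ s : ℝ, 0 < s ∧ S.width = s * R.width ∧ S.height = s * R.height

/-- The aspect ratio of a rectangle: length of the long side over length of the short side. -/
noncomputable def aspectRatio (R : Rectangle) : ℝ :=
  max R.width R.height / min R.width R.height

end Rectangle

/-- General position of a finite point set `P` with respect to the rectangle `R`: no four points
lie on the boundary of a scaled translate of `R`, and no two points lie on a common vertical or
horizontal line. -/
def GeneralPosition (R : Rectangle) (P : Finset Plane) : Prop :=
  (∀ S : Rectangle, S.IsHomothetOf R →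
    ∀ Q : Finset Plane, Q ⊆ P → (∀ q ∈ Q, q ∈ S.boundary) → Q.card ≤ 3) ∧
  (∀ p ∈ P, ∀ q ∈ P, p ≠ q → p 0 ≠ q 0 ∧ p 1 ≠ q 1)

/-- The rectangle Delaunay triangulation of `P` with respect to `R`: distinct vertices are adjacent
if and only if both lie on the boundary of some scaled translate of `R` whose interior contains
no vertex. -/
def rectangleDelaunay (R : Rectangle) (P : Finset Plane) : SimpleGraph {p : Plane // p ∈ P} where
  Adj u v := u ≠ v ∧ ∃ S : Rectangle, S.IsHomothetOf R ∧
    (u : Plane) ∈ S.boundary ∧ (v : Plane) ∈ S.boundary ∧ ∀ p ∈ P, p ∉ S.inner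
  symm := ⟨by
    rintro u v ⟨hne, S, hS, hu, hv, hP⟩
    exact ⟨hne.symm, S, hS, hv, hu, hP⟩⟩
  loopless := ⟨fun _ h => h.1 rfl⟩

/-- The total Euclidean length of the edges of a walk in a geometric graph. -/
noncomputable def walkLength {P : Finset Plane} {G : SimpleGraph {p : Plane // p ∈ P}}
    {u v : {p : Plane // p ∈ P}} (w : G.Walk u v) : ℝ :=
  (w.darts.map fun d => dist (d.fst : Plane) (d.snd : Plane)).sum

/-- The shortest path distance between two vertices of the rectangle Delaunay triangulation, where
edges have their Euclidean lengths. It is `∞` when there is no path from `u` to `v`. -/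
noncomputable def dt (R : Rectangle) (P : Finset Plane) (u v : {p : Plane // p ∈ P}) : ℝ≥0∞ :=
  ⨅ w : (rectangleDelaunay R P).Walk u v, ENNReal.ofReal (walkLength w)

/-!
The coordinate `x` is rescaled by the aspect ratio `A`, so that the homothets of the rectangle
become axis-parallel squares, and edges have length at most their `L¹` length as well as at most
`ν = √(1 / A ^ 2 + 1)` times their `L∞` length. In these coordinates both halves of the theorem
say that `u` and `v` are joined by a path of length at most `|Δx| + |Δy| + ν * max |Δx| |Δy|`. A
`SquareNet` records what the proof uses: the coordinates, the path lengths, and the fact that two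
vertices on an empty square are joined by an edge. It is stable under reflections and under
exchanging the axes.

The bound is proved by induction on the `L∞` distance (`SquareNet.conn_bound`). By symmetry `a` is
the lower left of the two points and `Δy ≤ Δx` (call such a pair *gentle*).

* If the rectangle spanned by `a` and `b` contains a further vertex, then either some vertex `c`
  in it makes both `(a, c)` and `(c, b)` gentle, and the two bounds add up; or the first vertex
  met by a square growing out of the corner `a`, or out of the corner `b`, lies in the rectangle,
  and the edge to it costs only its `L¹` length (`SquareNet.conn_of_corner`).

* If that rectangle is empty, an empty square is swept from `a` to `b`, pivoting on a vertex `l`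
  below and a vertex `h` above the rectangle (`SquareNet.IsFront`). A potential argument, in which
  the lengths of the paths to `l` and `h` plus the arc of the square from `l` to `h` through its
  right side stay at most four times the horizontal progress, survives each pivot
  (`IsFront.advances`). The sweep ends at `b`, reached at cost `2 * Δx`, or at the first gentle
  pivot edge. In the latter case its right endpoint `c` is reached within `(1 + ν) * Δx` minus the
  height `|y c - y a|` of `c` (`SquareNet.HasExit`). From `c`, edges of total `L¹` length lead
  monotonically towards `b` until the remaining pair is gentle and the induction hypothesis
  applies (`SquareNet.conn_of_clear`).
-/

/-! ### Nets of empty squares -/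

/-- A set of vertices with pairwise distinct `x`- and pairwise distinct `y`-coordinates, and a
relation `Conn p q r`, to be read as "there is a path from `p` to `q` of length at most `r`". Two
vertices in a closed square with no vertex in its interior (hence on its boundary) are joined by
an edge, whose length is at most the `L¹` distance, and at most `ν` times the `L∞` distance, of
its endpoints. -/
structure SquareNet (V : Type*) where
  x : V → ℝ
  y : V → ℝ
  ν : ℝ
  Conn : V → V → ℝ → Prop
  x_inj : Function.Injective x
  y_inj : Function.Injective y
  one_le_ν : 1 ≤ ν
  refl : ∀ p, Conn p p 0
  symm : ∀ {p q r}, Conn p q r → Conn q p r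
  trans : ∀ {p q z r s}, Conn p q r → Conn q z s → Conn p z (r + s)
  mono : ∀ {p q r s}, Conn p q r → r ≤ s → Conn p q s
  edge : ∀ {p q : V} {X Y s : ℝ}, 0 < s →
    (X ≤ x p ∧ x p ≤ X + s ∧ Y ≤ y p ∧ y p ≤ Y + s) →
    (X ≤ x q ∧ x q ≤ X + s ∧ Y ≤ y q ∧ y q ≤ Y + s) →
    (∀ v, X < x v → x v < X + s → Y < y v → y v < Y + s → False) →
    Conn p q (|x p - x q| + |y p - y q|) ∧ Conn p q (ν * max |x p - x q| |y p - y q|)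

namespace SquareNet

variable {V : Type*}

/-- The reflection of a net in the `x`-axis. -/
@[simps]
def flipY (N : SquareNet V) : SquareNet V where
  x := N.x
  y := fun p => -N.y p
  ν := N.ν
  Conn := N.Conn
  x_inj := N.x_inj
  y_inj := neg_injective.comp N.y_inj
  one_le_ν := N.one_le_ν
  refl := N.refl
  symm := N.symm
  trans := N.trans
  mono := N.mono
  edge := by
    intro p q X Y s hs hp hq hE
    have := N.edge (p := p) (q := q) (X := X) (Y := -Y - s) hs
      ⟨hp.1, hp.2.1, by linarith [hp.2.2.2], by linarith [hp.2.2.1]⟩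
      ⟨hq.1, hq.2.1, by linarith [hq.2.2.2], by linarith [hq.2.2.1]⟩
      (fun v h1 h2 h3 h4 => hE v h1 h2 (by linarith) (by linarith))
    simpa only [neg_sub_neg, abs_sub_comm] using this

/-- The net with its two coordinate axes exchanged. -/
@[simps]
def swap (N : SquareNet V) : SquareNet V where
  x := N.y
  y := N.x
  ν := N.ν
  Conn := N.Conn
  x_inj := N.y_inj
  y_inj := N.x_inj
  one_le_ν := N.one_le_ν
  refl := N.refl
  symm := N.symm
  trans := N.trans
  mono := N.mono
  edge := by
    intro p q X Y s hs hp hq hE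
    have := N.edge (p := p) (q := q) (X := Y) (Y := X) hs
      ⟨hp.2.2.1, hp.2.2.2, hp.1, hp.2.1⟩ ⟨hq.2.2.1, hq.2.2.2, hq.1, hq.2.1⟩
      (fun v h1 h2 h3 h4 => hE v h3 h4 h1 h2)
    rwa [add_comm, max_comm] at this

/-- The `L∞` distance of two vertices. -/
def linfDist (N : SquareNet V) (p q : V) : ℝ := max |N.x p - N.x q| |N.y p - N.y q|

/-- The path length to be proved sufficient: the `L¹` distance plus `ν` times the `L∞` distance. -/
def bound (N : SquareNet V) (p q : V) : ℝ :=
  |N.x p - N.x q| + |N.y p - N.y q| + N.ν * N.linfDist p q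

lemma linfDist_comm (N : SquareNet V) (p q : V) : N.linfDist p q = N.linfDist q p := by
  simp only [linfDist, abs_sub_comm]

lemma linfDist_swap (N : SquareNet V) (p q : V) : N.swap.linfDist p q = N.linfDist p q := by
  simp only [linfDist, swap, max_comm]

lemma linfDist_flipY (N : SquareNet V) (p q : V) : N.flipY.linfDist p q = N.linfDist p q := by
  simp only [linfDist, flipY, neg_sub_neg, abs_sub_comm]

lemma bound_comm (N : SquareNet V) (p q : V) : N.bound p q = N.bound q p := by
  simp only [bound, linfDist, abs_sub_comm]

lemma bound_swap (N : SquareNet V) (p q : V) : N.swap.bound p q = N.bound p q := by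
  simp only [bound, linfDist, swap, max_comm, add_comm]

lemma bound_flipY (N : SquareNet V) (p q : V) : N.flipY.bound p q = N.bound p q := by
  simp only [bound, linfDist, flipY, neg_sub_neg, abs_sub_comm]

lemma exists_least [Finite V] (S : V → Prop) (f : V → ℝ) (h : ∃ p, S p) :
    ∃ p, S p ∧ ∀ q, S q → f p ≤ f q :=
  Set.exists_min_image {p | S p} f (Set.toFinite _) h

/-! ### Descending to the target -/

/-- Among the vertices strictly between the heights of `c` and `b`, none lies to the left of `c`
within horizontal distance `|y c - y b|`: the square to the left of `c`, spanning these heights,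
is empty. -/
def ClearTowards (N : SquareNet V) (b c : V) : Prop :=
  ∀ q, N.x c - |N.y c - N.y b| < N.x q → N.x q < N.x c →
    ¬((N.y b < N.y q ∧ N.y q < N.y c) ∨ (N.y c < N.y q ∧ N.y q < N.y b))

lemma clearTowards_flipY {N : SquareNet V} {b c : V} (h : N.ClearTowards b c) :
    N.flipY.ClearTowards b c := by
  intro q h1 h2 h3
  rw [flipY_y, flipY_y, neg_sub_neg, abs_sub_comm] at h1
  simp only [flipY, neg_lt_neg_iff] at h1 h2 h3
  exact h q h1 h2 (by tauto)

/-- Starting at `h` above and to the left of `b`, the square of side `y h - y b` on the left of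
`h` is slid to the right until it meets a vertex `p`. The edge from `h` to `p` descends, and the
empty square on the left of `p` is again guaranteed, so this is repeated until the pair with `b`
is gentle. -/
lemma conn_of_clear_above [Finite V] (N : SquareNet V) {b : V} {x₀ : ℝ}
    (ih : ∀ p, x₀ ≤ N.x p → N.x p < N.x b → |N.y p - N.y b| ≤ N.x b - N.x p →
      N.Conn p b (N.bound p b)) (h : V) :
    x₀ ≤ N.x h → N.x h < N.x b → N.y b < N.y h → N.ClearTowards b h →
    N.Conn h b ((1 + N.ν) * (N.x b - N.x h) + (N.y h - N.y b)) := by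
  have wf : WellFounded (fun p q : V => N.x q < N.x p) := by
    have : IsTrans V (fun p q : V => N.x q < N.x p) := ⟨fun _ _ _ h1 h2 => h2.trans h1⟩
    have : Std.Irrefl (fun p q : V => N.x q < N.x p) := ⟨fun _ => lt_irrefl _⟩
    exact Finite.wellFounded_of_trans_of_irrefl _
  induction h using wf.induction with
  | _ h rec =>
  intro h0 hx hy hc
  have hν := N.one_le_ν
  rcases le_or_gt (N.y h - N.y b) (N.x b - N.x h) with hg | hg
  · have h1 := ih h h0 hx (by rw [abs_of_pos (by linarith)]; exact hg)
    refine N.mono h1 ?_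
    rw [bound, linfDist, abs_of_neg (by linarith : N.x h - N.x b < 0),
      abs_of_pos (by linarith : 0 < N.y h - N.y b), max_eq_left (by linarith)]
    linarith
  · obtain ⟨p, ⟨hp1, hp2, hp3⟩, hmin⟩ := exists_least
      (fun p => N.x h < N.x p ∧ N.y b ≤ N.y p ∧ N.y p < N.y h) N.x ⟨b, hx, le_rfl, hy⟩
    have hpb : N.x p ≤ N.x b := hmin b ⟨hx, le_rfl, hy⟩
    rw [ClearTowards, abs_of_pos (by linarith)] at hc
    have hE := (N.edge (p := h) (q := p) (X := N.x p - (N.y h - N.y b)) (Y := N.y b)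
      (s := N.y h - N.y b) (by linarith) (by constructorm* _ ∧ _ <;> linarith)
      (by constructorm* _ ∧ _ <;> linarith) (by
        intro v v1 v2 v3 v4
        rcases lt_trichotomy (N.x v) (N.x h) with hv | hv | hv
        · exact hc v (by linarith) hv (Or.inl ⟨v3, by linarith⟩)
        · have := N.x_inj hv
          subst this; linarith
        · linarith [hmin v ⟨hv, v3.le, by linarith⟩])).1
    rw [abs_of_neg (by linarith : N.x h - N.x p < 0),
      abs_of_pos (by linarith : 0 < N.y h - N.y p)] at hE
    rcases hp2.eq_or_lt with hpe | hpl
    · have := N.y_inj hpe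
      subst this
      refine N.mono hE ?_
      nlinarith
    · have hpb' : N.x p < N.x b := lt_of_le_of_ne hpb (fun e => by
        have := N.x_inj e
        subst this; linarith)
      have hr := rec p hp1 (by linarith) hpb' hpl (by
        intro q q1 q2 q3
        rw [abs_of_pos (by linarith)] at q1
        rcases q3 with q3 | q3
        · rcases lt_trichotomy (N.x q) (N.x h) with hv | hv | hv
          · exact hc q (by linarith) hv (Or.inl ⟨q3.1, by linarith⟩)
          · have := N.x_inj hv
            subst this; linarith
          · linarith [hmin q ⟨hv, q3.1.le, by linarith⟩]
        · linarith)
      refine N.mono (N.trans hE hr) ?_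
      nlinarith

lemma conn_of_clear [Finite V] (N : SquareNet V) {b : V} {x₀ : ℝ}
    (ih : ∀ p, x₀ ≤ N.x p → N.x p < N.x b → |N.y p - N.y b| ≤ N.x b - N.x p →
      N.Conn p b (N.bound p b)) (h : V)
    (h0 : x₀ ≤ N.x h) (hx : N.x h < N.x b) (hc : N.ClearTowards b h) :
    N.Conn h b ((1 + N.ν) * (N.x b - N.x h) + |N.y h - N.y b|) := by
  rcases lt_trichotomy (N.y b) (N.y h) with hy | hy | hy
  · rw [abs_of_pos (by linarith)]
    exact N.conn_of_clear_above ih h h0 hx hy hc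
  · have := N.y_inj hy
    subst this; linarith
  · have := N.flipY.conn_of_clear_above (b := b) (x₀ := x₀) (fun p p1 p2 p3 => by
      rw [bound_flipY]
      refine ih p p1 p2 ?_
      rwa [flipY_y, flipY_y, neg_sub_neg, abs_sub_comm] at p3) h h0 hx
      (by simpa only [flipY, neg_lt_neg_iff] using hy)
      (clearTowards_flipY hc)
    rw [abs_of_neg (by linarith)]
    refine N.mono this (le_of_eq ?_)
    simp only [flipY]; ring

/-! ### Sweeping an empty square from left to right -/

/-- Every vertex with `x`-coordinate strictly between those of `a` and `b` lies below the height
`lo` or above the height `hi`, whereas `a` and `b` lie between these heights. Stating this with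
`lo` and `hi` instead of `y a` and `y b` makes it symmetric under `flipY`. -/
structure EmptyStrip (N : SquareNet V) (a b : V) (lo hi : ℝ) : Prop where
  x_lt : N.x a < N.x b
  lo_le_left : lo ≤ N.y a
  left_le_hi : N.y a ≤ hi
  lo_le_right : lo ≤ N.y b
  right_le_hi : N.y b ≤ hi
  sep : ∀ p, N.x a < N.x p → N.x p < N.x b → N.y p < lo ∨ hi < N.y p

/-- A position of the sweep: the empty square `[X - s, X] × [y l, y h]` of side `s = y h - y l`,
with the low vertex `l` on its bottom and the high vertex `h` on its top side, where the pair `l`,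
`h` is not gentle. Paths of length at most `dl` and `dh` lead from `a` to `l` and `h`. In the
field `potential`, the third summand is the length of the boundary arc from `l` to `h` through the
right side. -/
structure IsFront (N : SquareNet V) (a b : V) (lo hi : ℝ) (l h : V) (X dl dh : ℝ) : Prop where
  low : N.y l ≤ lo
  high : hi ≤ N.y h
  left_l : N.x a ≤ N.x l
  left_h : N.x a ≤ N.x h
  right_l : N.x l < N.x b
  right_h : N.x h < N.x b
  l_le : N.x l ≤ X
  h_le : N.x h ≤ X
  le_l : X ≤ N.x l + (N.y h - N.y l)
  le_h : X ≤ N.x h + (N.y h - N.y l)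
  le_b : X ≤ N.x b
  steep : |N.x h - N.x l| < N.y h - N.y l
  clear : ∀ q, X - (N.y h - N.y l) < N.x q → N.x q < X → N.y l < N.y q → N.y q < N.y h → False
  conn_l : N.Conn a l dl
  conn_h : N.Conn a h dh
  dl_le : dl ≤ 2 * (N.x l - N.x a) + |N.y l - N.y a|
  dh_le : dh ≤ 2 * (N.x h - N.x a) + |N.y h - N.y a|
  potential : dl + dh + (2 * X - N.x h - N.x l + (N.y h - N.y l)) ≤ 4 * (X - N.x a)

/-- The outcome of the sweep: `b` itself is reached, or a vertex `c` from which the descent to `b`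
is possible, by a path short enough to leave room for the height `|y c - y a|`. -/
def HasExit (N : SquareNet V) (a b : V) : Prop :=
  N.Conn a b (2 * (N.x b - N.x a)) ∨
  ∃ c d, N.x a < N.x c ∧ N.x c < N.x b ∧ N.Conn a c d ∧
    d + |N.y c - N.y a| ≤ (1 + N.ν) * (N.x c - N.x a) ∧ N.ClearTowards b c

lemma hasExit_of_flipY {N : SquareNet V} {a b : V} (h : N.flipY.HasExit a b) :
    N.HasExit a b := by
  rcases h with h | ⟨c, d, h1, h2, h3, h4, h5⟩
  · exact Or.inl h
  · refine Or.inr ⟨c, d, h1, h2, h3, ?_, ?_⟩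
    · rwa [flipY_y, flipY_y, neg_sub_neg, abs_sub_comm] at h4
    · have := clearTowards_flipY h5
      simpa only [ClearTowards, flipY, neg_neg] using this

lemma EmptyStrip.flipY {N : SquareNet V} {a b : V} {lo hi : ℝ} (h : N.EmptyStrip a b lo hi) :
    N.flipY.EmptyStrip a b (-hi) (-lo) where
  x_lt := h.x_lt
  lo_le_left := neg_le_neg h.left_le_hi
  left_le_hi := neg_le_neg h.lo_le_left
  lo_le_right := neg_le_neg h.right_le_hi
  right_le_hi := neg_le_neg h.lo_le_right
  sep := fun p h1 h2 => by
    simpa only [SquareNet.flipY, neg_lt_neg_iff] using (h.sep p h1 h2).symm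

lemma IsFront.flipY {N : SquareNet V} {a b l h : V} {lo hi X dl dh : ℝ}
    (F : N.IsFront a b lo hi l h X dl dh) :
    N.flipY.IsFront a b (-hi) (-lo) h l X dh dl := by
  have e : ∀ p q, |(-N.y p) - (-N.y q)| = |N.y p - N.y q| := by
    intro p q; rw [← abs_neg]; congr 1; ring
  constructor <;> simp only [SquareNet.flipY, e]
  · exact neg_le_neg F.high
  · exact neg_le_neg F.low
  · exact F.left_h
  · exact F.left_l
  · exact F.right_h
  · exact F.right_l
  · exact F.h_le
  · exact F.l_le
  · linarith [F.le_h]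
  · linarith [F.le_l]
  · exact F.le_b
  · rw [abs_sub_comm]; linarith [F.steep]
  · exact fun q h1 h2 h3 h4 => F.clear q (by linarith) h2 (by linarith) (by linarith)
  · exact F.conn_h
  · exact F.conn_l
  · exact F.dh_le
  · exact F.dl_le
  · linarith [F.potential]

/-- The sweep ends, or the pivots can be replaced by ones further to the right; in a finite net the
latter happens only finitely often. -/
def Advances (N : SquareNet V) (a b : V) (lo hi : ℝ) (l h : V) : Prop :=
  N.HasExit a b ∨ ∃ l' h' X dl dh, N.IsFront a b lo hi l' h' X dl dh ∧
    N.x l + N.x h < N.x l' + N.x h'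

/-- The square moving or growing to the right meets the vertex `c` with its right side. Here `c`
is within `2 * (x c - x a)` of `a`: the two ways to `c`, via `l` and via `h`, have total length at
most four times that distance by the potential. The vertex `c` replaces the pivot on its own side,
unless the edge to the other pivot is gentle, in which case that edge gives the exit. -/
lemma IsFront.advances_of_east {N : SquareNet V} {a b l h : V} {lo hi X dl dh : ℝ}
    (E : N.EmptyStrip a b lo hi) (F : N.IsFront a b lo hi l h X dl dh) {c : V} {s : ℝ}
    (hs : N.y h - N.y l ≤ s) (hsX : s - (N.y h - N.y l) ≤ N.x c - X)
    (hl : N.x c - s ≤ N.x l) (hh : N.x c - s ≤ N.x h) (hlc : N.x l < N.x c) (hhc : N.x h < N.x c)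
    (hcb : N.x c ≤ N.x b)
    (hc : N.y h - s ≤ N.y c) (hch : N.y c < N.y h)
    (hclear : ∀ v, N.x c - s < N.x v → N.x v < N.x c → N.y h - s < N.y v → N.y v < N.y h → False) :
    N.Advances a b lo hi l h := by
  have hν := N.one_le_ν
  have steep := abs_lt.1 F.steep
  have := F.l_le; have := F.h_le; have := F.left_l; have := F.left_h
  have := F.low; have := F.high; have := E.lo_le_left; have := E.left_le_hi
  have := E.lo_le_right; have := E.right_le_hi
  have hs0 : 0 < s := by linarith [steep.1, steep.2]
  have hclear' : ∀ v, N.x c - s < N.x v → N.x v < N.x c - s + s → N.y h - s < N.y v →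
      N.y v < N.y h - s + s → False :=
    fun v h1 h2 h3 h4 => hclear v h1 (by linarith) h3 (by linarith)
  have el := N.edge (p := l) (q := c) hs0 (by constructorm* _ ∧ _ <;> linarith)
    (by constructorm* _ ∧ _ <;> linarith) hclear'
  have eh := N.edge (p := h) (q := c) hs0 (by constructorm* _ ∧ _ <;> linarith)
    (by constructorm* _ ∧ _ <;> linarith) hclear'
  rw [abs_of_neg (by linarith : N.x l - N.x c < 0)] at el
  rw [abs_of_neg (by linarith : N.x h - N.x c < 0),
    abs_of_pos (by linarith : 0 < N.y h - N.y c)] at eh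
  have hpot := F.potential
  have hav : |N.y l - N.y c| ≤ 2 * s - 2 * (N.y h - N.y l) + (N.y c - N.y l) := by
    rw [abs_le]; constructor <;> linarith
  have hyl : |N.y l - N.y a| = N.y a - N.y l := by
    rw [abs_of_nonpos (by linarith)]; ring
  have hyh : |N.y h - N.y a| = N.y h - N.y a := abs_of_nonneg (by linarith)
  have hdl := F.dl_le
  have hdh := F.dh_le
  rw [hyl] at hdl
  rw [hyh] at hdh
  -- The shorter of the two ways to `c` is at most their average, which the potential controls.
  obtain ⟨dc, hdc, hdc1, hdc2, hdc3⟩ : ∃ dc, N.Conn a c dc ∧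
      dc ≤ dl + (-(N.x l - N.x c) + |N.y l - N.y c|) ∧
      dc ≤ dh + (-(N.x h - N.x c) + (N.y h - N.y c)) ∧ dc ≤ 2 * (N.x c - N.x a) := by
    rcases le_total (dl + (-(N.x l - N.x c) + |N.y l - N.y c|))
      (dh + (-(N.x h - N.x c) + (N.y h - N.y c))) with h1 | h1
    · exact ⟨_, N.trans F.conn_l el.1, le_rfl, h1, by linarith⟩
    · exact ⟨_, N.trans F.conn_h eh.1, h1, le_rfl, by linarith⟩
  rcases hcb.eq_or_lt with hcb | hcb
  · have := N.x_inj hcb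
    subst this
    exact Or.inl (Or.inl (N.mono hdc hdc3))
  rcases E.sep c (by linarith) hcb with hc' | hc'
  · have hclr : N.ClearTowards b c := by
      intro q q1 q2 q3
      rw [abs_of_neg (by linarith)] at q1
      rcases q3 with q3 | q3
      · linarith
      · exact hclear q (by linarith) q2 (by linarith) (by linarith)
    rcases le_or_gt (N.y h - N.y c) (N.x c - N.x h) with hg | hg
    · refine Or.inl (Or.inr ⟨c, _, by linarith, hcb, N.trans F.conn_h eh.2, ?_, hclr⟩)
      rw [max_eq_left (by linarith), abs_of_neg (by linarith)]
      nlinarith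
    · refine Or.inr ⟨c, h, N.x c, dc, dh, ⟨hc'.le, F.high, by linarith, F.left_h, hcb, F.right_h,
        le_rfl, hhc.le, by linarith, by linarith, hcb.le, ?_, ?_, hdc, F.conn_h, ?_, F.dh_le, ?_⟩,
        by linarith⟩
      · rw [abs_lt]; constructor <;> linarith
      · exact fun q q1 q2 q3 q4 => hclear q (by linarith) q2 (by linarith) q4
      · linarith [abs_nonneg (N.y c - N.y a)]
      · linarith
  · have hclr : N.ClearTowards b c := by
      intro q q1 q2 q3
      rw [abs_of_pos (by linarith)] at q1
      rcases q3 with q3 | q3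
      · exact hclear q (by linarith) q2 (by linarith) (by linarith)
      · linarith
    rw [abs_of_neg (by linarith : N.y l - N.y c < 0)] at el hdc1
    rcases le_or_gt (N.y c - N.y l) (N.x c - N.x l) with hg | hg
    · refine Or.inl (Or.inr ⟨c, _, by linarith, hcb, N.trans F.conn_l el.2, ?_, hclr⟩)
      rw [max_eq_left (by linarith), abs_of_pos (by linarith)]
      nlinarith
    · refine Or.inr ⟨l, c, N.x c, dl, dc, ⟨F.low, hc'.le, F.left_l, by linarith, F.right_l, hcb,
        hlc.le, le_rfl, by linarith, by linarith, hcb.le, ?_, ?_, F.conn_l, hdc, F.dl_le, ?_, ?_⟩,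
        by linarith⟩
      · rw [abs_lt]; constructor <;> linarith
      · exact fun q q1 q2 q3 q4 => hclear q (by linarith) q2 (by linarith) (by linarith)
      · linarith [abs_nonneg (N.y c - N.y a)]
      · linarith

/-- When `l` is to the left of `h`, the square slides to the right until its left side reaches
`l`, and from then on grows with its upper left corner `(x l, y h)` fixed. A vertex met while
growing is on the right side, or on the bottom side, in which case it becomes the new low pivot.
-/
lemma IsFront.advances_of_lt [Finite V] {N : SquareNet V} {a b l h : V} {lo hi X dl dh : ℝ}
    (E : N.EmptyStrip a b lo hi) (F : N.IsFront a b lo hi l h X dl dh) (hlh : N.x l < N.x h) :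
    N.Advances a b lo hi l h := by
  have steep := abs_lt.1 F.steep
  have := F.l_le; have := F.h_le; have := F.left_l; have := F.left_h; have := F.le_l
  have := F.low; have := F.high; have := E.lo_le_left; have := E.left_le_hi
  have := E.lo_le_right; have := E.right_le_hi; have := F.right_l; have := F.right_h
  have hbl : N.y l < N.y b := lt_of_le_of_ne (by linarith) (fun e => by
    have := N.y_inj e
    subst this; linarith)
  have hbh : N.y b < N.y h := lt_of_le_of_ne (by linarith) (fun e => by
    have := N.y_inj e
    subst this; linarith)
  by_cases hA : ∃ p, X ≤ N.x p ∧ N.x p ≤ N.x l + (N.y h - N.y l) ∧ N.y l < N.y p ∧ N.y p < N.y h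
  · -- A vertex is met while sliding.
    obtain ⟨c, ⟨c1, c2, c3, c4⟩, hmin⟩ := exists_least _ N.x hA
    have hcl : N.x l < N.x c := by linarith
    have hch : N.x h < N.x c := lt_of_le_of_ne (by linarith) (fun e => by
      have := N.x_inj e
      subst this; linarith)
    refine F.advances_of_east E le_rfl (by linarith) (by linarith) (by linarith) hcl hch ?_
      (by linarith) c4 ?_
    · rcases le_or_gt (N.x b) (N.x l + (N.y h - N.y l)) with h1 | h1
      · exact hmin b ⟨F.le_b, h1, hbl, hbh⟩
      · linarith
    · intro v v1 v2 v3 v4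
      rcases lt_or_ge (N.x v) X with h1 | h1
      · exact F.clear v (by linarith) h1 (by linarith) v4
      · linarith [hmin v ⟨h1, by linarith, by linarith, v4⟩]
  · -- The square slides all the way; `hbox` says that it is empty in its extreme position.
    push Not at hA
    have hbox : ∀ q, N.x l < N.x q → N.x q ≤ N.x l + (N.y h - N.y l) → N.y l < N.y q →
        N.y q < N.y h → False := by
      intro q q1 q2 q3 q4
      rcases lt_or_ge (N.x q) X with h1 | h1
      · exact F.clear q (by linarith) h1 q3 q4
      · exact absurd (hA q h1 q2 q3) (by linarith)
    obtain ⟨c, ⟨c1, c2⟩, hmin⟩ := exists_least (fun p => N.x l < N.x p ∧ N.y p < N.y h)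
      (fun p => max (N.x p - N.x l) (N.y h - N.y p)) ⟨b, F.right_l, hbh⟩
    have hbx : N.x l + (N.y h - N.y l) < N.x b := by
      by_contra hcon
      exact hbox b F.right_l (by linarith) hbl hbh
    have hTb : max (N.x c - N.x l) (N.y h - N.y c) ≤ N.x b - N.x l := by
      have := hmin b ⟨F.right_l, hbh⟩
      rwa [max_eq_left (by linarith : N.y h - N.y b ≤ N.x b - N.x l)] at this
    have hcy : N.y c ≠ N.y l := fun e => by
      have := N.y_inj e
      subst this; linarith
    rcases le_or_gt (N.y h - N.y c) (N.x c - N.x l) with hg | hg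
    · rw [max_eq_left hg] at hTb hmin
      have hd : N.y h - N.y l < N.x c - N.x l := by
        rcases lt_or_gt_of_ne hcy with h1 | h1
        · linarith
        · by_contra hcon
          exact hbox c c1 (by linarith) h1 c2
      refine F.advances_of_east E (s := N.x c - N.x l) hd.le (by linarith) (by linarith)
        (by linarith) c1
        (by linarith) (by linarith) (by linarith) c2 ?_
      intro v v1 v2 v3 v4
      have := hmin v ⟨by linarith, v4⟩
      rcases le_max_iff.1 this with h1 | h1 <;> linarith
    · rw [max_eq_right hg.le] at hTb hmin
      have hcl : N.y c < N.y l := by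
        rcases lt_or_gt_of_ne hcy with h1 | h1
        · exact h1
        · exact (hbox c c1 (by linarith) h1 c2).elim
      have hclear : ∀ v, N.x l < N.x v → N.x v < N.x l + (N.y h - N.y c) → N.y c < N.y v →
          N.y v < N.y h → False := by
        intro v v1 v2 v3 v4
        have := hmin v ⟨v1, v4⟩
        rcases le_max_iff.1 this with h1 | h1 <;> linarith
      have el := (N.edge (p := l) (q := c) (X := N.x l) (Y := N.y c) (s := N.y h - N.y c)
        (by linarith) (by constructorm* _ ∧ _ <;> linarith) (by constructorm* _ ∧ _ <;> linarith)
        (fun v h1 h2 h3 h4 => hclear v h1 h2 h3 (by linarith))).1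
      rw [abs_of_neg (by linarith : N.x l - N.x c < 0),
        abs_of_pos (by linarith : 0 < N.y l - N.y c)] at el
      have hdl := F.dl_le
      rw [abs_of_nonpos (by linarith)] at hdl
      refine Or.inr ⟨c, h, N.x l + (N.y h - N.y c), _, dh, ⟨by linarith, F.high, by linarith,
        F.left_h, by linarith, F.right_h, by linarith, by linarith, by linarith, by linarith,
        by linarith, ?_, ?_, N.trans F.conn_l el, F.conn_h, ?_, F.dh_le, ?_⟩, by linarith⟩
      · rw [abs_lt]; constructor <;> linarith
      · exact fun q q1 q2 q3 q4 => hclear q (by linarith) q2 q3 q4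
      · rw [abs_of_neg (by linarith)]; linarith
      · linarith [F.potential]

lemma IsFront.advances [Finite V] {N : SquareNet V} {a b l h : V} {lo hi X dl dh : ℝ}
    (E : N.EmptyStrip a b lo hi) (F : N.IsFront a b lo hi l h X dl dh) :
    N.Advances a b lo hi l h := by
  rcases lt_trichotomy (N.x l) (N.x h) with hlh | hlh | hlh
  · exact F.advances_of_lt E hlh
  · have := N.x_inj hlh
    subst this
    have := F.steep
    simp at this
  · rcases F.flipY.advances_of_lt E.flipY hlh with h1 | ⟨l', h', X', dl', dh', h1, h2⟩
    · exact Or.inl (hasExit_of_flipY h1)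
    · refine Or.inr ⟨h', l', X', dh', dl', ?_, ?_⟩
      · simpa only [SquareNet.flipY, neg_neg] using h1.flipY
      · simp only [SquareNet.flipY] at h2
        linarith

lemma IsFront.hasExit [Finite V] {N : SquareNet V} {a b l h : V} {lo hi X dl dh : ℝ}
    (E : N.EmptyStrip a b lo hi) (F : N.IsFront a b lo hi l h X dl dh) :
    N.HasExit a b := by
  obtain ⟨⟨l, h⟩, ⟨X, dl, dh, F⟩, hmax⟩ := Set.exists_max_image
    {p : V × V | ∃ X dl dh, N.IsFront a b lo hi p.1 p.2 X dl dh} (fun p => N.x p.1 + N.x p.2)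
    (Set.toFinite _) ⟨(l, h), X, dl, dh, F⟩
  rcases F.advances E with h1 | ⟨l', h', X', dl', dh', F', h1⟩
  · exact h1
  · exact absurd (hmax (l', h') ⟨X', dl', dh', F'⟩) (not_le.2 h1)

/-- The first vertex `p` met by the square growing out of its lower left corner `a`, and the side
`s` of the square at that moment. -/
lemma exists_corner_edge [Finite V] (N : SquareNet V) {a b : V} (hx : N.x a < N.x b)
    (hy : N.y a < N.y b) :
    ∃ p s, 0 < s ∧ max (N.x p - N.x a) (N.y p - N.y a) = s ∧
      s ≤ max (N.x b - N.x a) (N.y b - N.y a) ∧ N.x a < N.x p ∧ N.y a < N.y p ∧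
      (∀ v, N.x a < N.x v → N.x v < N.x a + s → N.y a < N.y v → N.y v < N.y a + s → False) ∧
      N.Conn a p ((N.x p - N.x a) + (N.y p - N.y a)) ∧ N.Conn a p (N.ν * s) := by
  obtain ⟨p, ⟨p1, p2⟩, hmin⟩ := exists_least (fun p => N.x a < N.x p ∧ N.y a < N.y p)
      (fun p => max (N.x p - N.x a) (N.y p - N.y a)) ⟨b, hx, hy⟩
  obtain ⟨s, hs⟩ : ∃ s, max (N.x p - N.x a) (N.y p - N.y a) = s := ⟨_, rfl⟩
  have hsx : N.x p - N.x a ≤ s := hs ▸ le_max_left _ _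
  have hsy : N.y p - N.y a ≤ s := hs ▸ le_max_right _ _
  have hclear : ∀ v, N.x a < N.x v → N.x v < N.x a + s → N.y a < N.y v → N.y v < N.y a + s →
      False := by
    intro v v1 v2 v3 v4
    have h1 := hmin v ⟨v1, v3⟩
    have h2 := max_lt (by linarith : N.x v - N.x a < s) (by linarith : N.y v - N.y a < s)
    linarith
  have e := N.edge (p := a) (q := p) (X := N.x a) (Y := N.y a) (s := s) (by linarith)
    (by constructorm* _ ∧ _ <;> linarith) (by constructorm* _ ∧ _ <;> linarith) hclear
  rw [abs_sub_comm, abs_sub_comm (N.y a), abs_of_pos (by linarith : 0 < N.x p - N.x a),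
    abs_of_pos (by linarith : 0 < N.y p - N.y a), hs] at e
  exact ⟨p, s, by linarith, hs, hs ▸ hmin b ⟨hx, hy⟩, p1, p2, hclear, e⟩

/-- The sweep starts with the square growing out of its lower left corner `a`, where `a` itself
serves as the low pivot unless the first vertex met is on the right side. -/
lemma hasExit_or_conn [Finite V] (N : SquareNet V) {a b : V} (hx : N.x a < N.x b)
    (hy : N.y a < N.y b) (hg : N.y b - N.y a ≤ N.x b - N.x a)
    (hE : ∀ p, N.x a < N.x p → N.x p < N.x b → N.y a < N.y p → N.y p < N.y b → False) :
    N.Conn a b (N.bound a b) ∨ N.HasExit a b := by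
  have hν := N.one_le_ν
  have E : N.EmptyStrip a b (N.y a) (N.y b) := ⟨hx, le_rfl, hy.le, hy.le, le_rfl, by
    intro p p1 p2
    by_contra! hcon
    refine hE p p1 p2 (lt_of_le_of_ne hcon.1 fun e => ?_) (lt_of_le_of_ne hcon.2 fun e => ?_)
    · have := N.y_inj e
      subst this; linarith
    · have := N.y_inj e
      subst this; linarith⟩
  obtain ⟨c, s, hs0, hs, hTb, c1, c2, hclear, ec1, ec2⟩ := N.exists_corner_edge hx hy
  rw [max_eq_left hg] at hTb
  have hsx : N.x c - N.x a ≤ s := hs ▸ le_max_left _ _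
  have hcb : N.x c ≤ N.x b := by linarith
  rcases hcb.eq_or_lt with hcb | hcb
  · have := N.x_inj hcb
    subst this
    refine Or.inl (N.mono ec1 ?_)
    rw [bound, abs_of_neg (by linarith), abs_of_neg (by linarith)]
    have : 0 ≤ N.ν * N.linfDist a c :=
      mul_nonneg (by linarith) (le_max_of_le_left (abs_nonneg _))
    linarith
  have hcy : N.y b < N.y c := by
    rcases E.sep c c1 hcb with h1 | h1 <;> linarith
  right
  rcases le_or_gt (N.y c - N.y a) (N.x c - N.x a) with h1 | h1
  · rw [max_eq_left h1] at hs
    refine Or.inr ⟨c, _, c1, hcb, ec2, ?_, ?_⟩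
    · rw [← hs, abs_of_pos (by linarith)]
      linarith
    · intro q q1 q2 q3
      rw [abs_of_pos (by linarith)] at q1
      rcases q3 with q3 | q3
      · exact hclear q (by linarith) (by linarith) (by linarith) (by linarith)
      · linarith
  · rw [max_eq_right h1.le] at hs
    refine IsFront.hasExit E (l := a) (h := c) (X := N.x a + (N.y c - N.y a)) (dl := 0)
      ⟨le_rfl, hcy.le, le_rfl, c1.le, hx, hcb, by linarith, by linarith, by linarith, by linarith,
        by linarith, ?_, ?_, N.refl a, ec1, ?_, ?_, ?_⟩
    · rw [abs_lt]; constructor <;> linarith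
    · exact fun q q1 q2 q3 q4 => hclear q (by linarith) (by linarith) q3 (by linarith)
    · simp
    · rw [abs_of_pos (by linarith)]; linarith
    · linarith


/-! ### The induction -/

/-- If the square growing out of the corner `a` meets its first vertex inside the rectangle
spanned by `a` and `b`, then the edge to that vertex is paid for by the `L¹` part of the bound. -/
lemma conn_of_corner [Finite V] (N : SquareNet V) {a b c : V}
    (ih : ∀ p q, N.linfDist p q < N.linfDist a b → N.Conn p q (N.bound p q))
    (hx : N.x a < N.x c) (hy : N.y a < N.y c)
    (hcx : max (N.x c - N.x a) (N.y c - N.y a) ≤ N.x b - N.x a)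
    (hcy : max (N.x c - N.x a) (N.y c - N.y a) ≤ N.y b - N.y a) :
    N.Conn a b (N.bound a b) := by
  have hν := N.one_le_ν
  obtain ⟨p, s, hs0, hs, hsc, p1, p2, -, ep, -⟩ := N.exists_corner_edge hx hy
  have hsx : N.x p - N.x a ≤ s := hs ▸ le_max_left _ _
  have hsy : N.y p - N.y a ≤ s := hs ▸ le_max_right _ _
  have hlt : N.linfDist p b < N.linfDist a b := by
    rw [linfDist, linfDist, abs_of_nonpos (by linarith), abs_of_nonpos (by linarith),
      abs_of_neg (by linarith), abs_of_neg (by linarith)]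
    exact max_lt_max (by linarith) (by linarith)
  refine N.mono (N.trans ep (ih p b hlt)) ?_
  rw [bound, bound, abs_of_nonpos (by linarith), abs_of_nonpos (by linarith),
      abs_of_neg (by linarith), abs_of_neg (by linarith)]
  nlinarith

/-- The rotation of a net by a half-turn. -/
def rotate (N : SquareNet V) : SquareNet V := N.flipY.swap.flipY.swap

lemma conn_of_lt_of_lt_of_gentle [Finite V] (N : SquareNet V) {a b : V}
    (ih : ∀ p q, N.linfDist p q < N.linfDist a b → N.Conn p q (N.bound p q))
    (hx : N.x a < N.x b) (hy : N.y a < N.y b) (hg : N.y b - N.y a ≤ N.x b - N.x a) :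
    N.Conn a b (N.bound a b) := by
  have hν := N.one_le_ν
  have hab : N.linfDist a b = N.x b - N.x a := by
    rw [linfDist, abs_sub_comm, abs_sub_comm (N.y a), abs_of_pos (by linarith),
      abs_of_pos (by linarith), max_eq_left hg]
  by_cases hE : ∃ p, N.x a < N.x p ∧ N.x p < N.x b ∧ N.y a < N.y p ∧ N.y p < N.y b
  · obtain ⟨c, c1, c2, c3, c4⟩ := hE
    rcases lt_or_ge (N.x c - N.x a) (N.y c - N.y a) with ha | ha
    · refine N.conn_of_corner ih c1 c3 ?_ ?_ <;> rw [max_eq_right ha.le] <;> linarith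
    rcases lt_or_ge (N.x b - N.x c) (N.y b - N.y c) with hb | hb
    · have h := N.rotate.conn_of_corner (a := b) (b := a) (c := c) (fun p q hpq => by
        simp only [rotate, bound_swap, bound_flipY, linfDist_swap, linfDist_flipY] at hpq ⊢
        rw [N.linfDist_comm b] at hpq
        exact ih p q hpq) (neg_lt_neg c2) (neg_lt_neg c4)
        (max_le (by simp [rotate]; linarith) (by simp [rotate]; linarith))
        (max_le (by simp [rotate]; linarith) (by simp [rotate]; linarith))
      simp only [rotate, bound_swap, bound_flipY] at h
      rw [bound_comm]
      exact N.symm h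
    · have dac : N.linfDist a c = N.x c - N.x a := by
        rw [linfDist, abs_sub_comm, abs_sub_comm (N.y a), abs_of_pos (by linarith),
          abs_of_pos (by linarith), max_eq_left ha]
      have dcb : N.linfDist c b = N.x b - N.x c := by
        rw [linfDist, abs_sub_comm, abs_sub_comm (N.y c), abs_of_pos (by linarith),
          abs_of_pos (by linarith), max_eq_left hb]
      refine N.mono (N.trans (ih a c (by linarith)) (ih c b (by linarith))) (le_of_eq ?_)
      rw [bound, bound, bound, dac, dcb, hab, abs_of_neg (by linarith), abs_of_neg (by linarith),
        abs_of_neg (by linarith), abs_of_neg (by linarith), abs_of_neg (by linarith),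
        abs_of_neg (by linarith)]
      ring
  · push Not at hE
    rcases N.hasExit_or_conn hx hy hg (fun p p1 p2 p3 p4 => absurd (hE p p1 p2 p3) (by linarith))
      with h | h | ⟨c, d, c1, c2, hd, hdle, hclr⟩
    · exact h
    · refine N.mono h ?_
      rw [bound, hab, abs_of_neg (by linarith)]
      have := abs_nonneg (N.y a - N.y b)
      nlinarith
    · have h := N.conn_of_clear (b := b) (x₀ := N.x c) (fun p p1 p2 p3 => ih p b (by
        rw [hab, linfDist, abs_of_neg (by linarith)]
        exact max_lt (by linarith) (by linarith))) c le_rfl c2 hclr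
      refine N.mono (N.trans hd h) ?_
      rw [bound, hab, abs_of_neg (by linarith : N.x a - N.x b < 0)]
      have h3 := abs_sub_le (N.y c) (N.y a) (N.y b)
      linarith

lemma conn_of_gentle [Finite V] (N : SquareNet V) {a b : V}
    (ih : ∀ p q, N.linfDist p q < N.linfDist a b → N.Conn p q (N.bound p q))
    (hx : N.x a < N.x b) (hg : |N.y b - N.y a| ≤ N.x b - N.x a) :
    N.Conn a b (N.bound a b) := by
  rcases lt_trichotomy (N.y a) (N.y b) with hy | hy | hy
  · exact N.conn_of_lt_of_lt_of_gentle ih hx hy ((le_abs_self _).trans hg)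
  · have := N.y_inj hy
    subst this; linarith
  · have h := N.flipY.conn_of_lt_of_lt_of_gentle (a := a) (b := b) (fun p q hpq => by
      rw [bound_flipY]
      rw [linfDist_flipY, linfDist_flipY] at hpq
      exact ih p q hpq) hx (neg_lt_neg hy) (by
        have := neg_le_abs (N.y b - N.y a)
        simp only [flipY]; linarith)
    rwa [bound_flipY] at h

lemma conn_of_abs_le [Finite V] (N : SquareNet V) {a b : V}
    (ih : ∀ p q, N.linfDist p q < N.linfDist a b → N.Conn p q (N.bound p q))
    (hab : a ≠ b) (hg : |N.y a - N.y b| ≤ |N.x a - N.x b|) : N.Conn a b (N.bound a b) := by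
  rcases lt_or_gt_of_ne (N.x_inj.ne hab) with hx | hx
  · refine N.conn_of_gentle ih hx ?_
    rwa [abs_of_neg (by linarith : N.x a - N.x b < 0), abs_sub_comm, neg_sub] at hg
  · rw [N.bound_comm]
    rw [N.linfDist_comm] at ih
    refine N.symm (N.conn_of_gentle ih hx ?_)
    rwa [abs_of_pos (by linarith : 0 < N.x a - N.x b)] at hg

/-- In a finite net any two vertices are joined by a path within the bound; the induction on the
`L∞` distance is run on a counterexample minimizing it. -/
theorem conn_bound [Finite V] (N : SquareNet V) (a b : V) : N.Conn a b (N.bound a b) := by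
  by_contra hcon
  obtain ⟨⟨a, b⟩, hab, hmin⟩ := exists_least (V := V × V)
    (fun p => ¬ N.Conn p.1 p.2 (N.bound p.1 p.2)) (fun p => N.linfDist p.1 p.2) ⟨(a, b), hcon⟩
  refine hab ?_
  have ih : ∀ p q, N.linfDist p q < N.linfDist a b → N.Conn p q (N.bound p q) := by
    intro p q hpq
    by_contra h
    exact absurd (hmin (p, q) h) (not_le.2 hpq)
  rcases eq_or_ne a b with rfl | hne
  · exact N.mono (N.refl a) (by simp [bound, linfDist])
  rcases le_total |N.y a - N.y b| |N.x a - N.x b| with hg | hg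
  · exact N.conn_of_abs_le ih hne hg
  · have h := N.swap.conn_of_abs_le (a := a) (b := b) (fun p q hpq => by
      rw [bound_swap]
      rw [linfDist_swap, linfDist_swap] at hpq
      exact ih p q hpq) hne hg
    rwa [bound_swap] at h

end SquareNet

/-! ### The rectangle Delaunay triangulation as a net -/

/-- There is a walk from `u` to `v` of length at most `r`. -/
def WalkLE {P : Finset Plane} (G : SimpleGraph {p : Plane // p ∈ P}) (u v : {p : Plane // p ∈ P})
    (r : ℝ) : Prop :=
  ∃ w : G.Walk u v, walkLength w ≤ r

namespace WalkLE

variable {P : Finset Plane} {G : SimpleGraph {p : Plane // p ∈ P}} {u v z : {p : Plane // p ∈ P}}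
  {r s : ℝ}

lemma refl (u : {p : Plane // p ∈ P}) : WalkLE G u u 0 := ⟨.nil, by simp [walkLength]⟩

lemma of_adj (h : G.Adj u v) : WalkLE G u v (dist (u : Plane) v) :=
  ⟨h.toWalk, by simp [walkLength]⟩

lemma symm : WalkLE G u v r → WalkLE G v u r := by
  rintro ⟨w, hw⟩
  refine ⟨w.reverse, le_of_eq_of_le ?_ hw⟩
  simp [walkLength, SimpleGraph.Walk.darts_reverse, Function.comp_def, dist_comm]

lemma trans : WalkLE G u v r → WalkLE G v z s → WalkLE G u z (r + s) := by
  rintro ⟨w, hw⟩ ⟨w', hw'⟩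
  refine ⟨w.append w', le_of_eq_of_le ?_ (add_le_add hw hw')⟩
  simp [walkLength, SimpleGraph.Walk.darts_append]

lemma mono (h : WalkLE G u v r) (hrs : r ≤ s) : WalkLE G u v s :=
  h.imp fun _ hw => hw.trans hrs

lemma dt_le {R : Rectangle} (h : WalkLE (rectangleDelaunay R P) u v r) :
    dt R P u v ≤ ENNReal.ofReal r := by
  obtain ⟨w, hw⟩ := h
  exact (iInf_le _ w).trans (ENNReal.ofReal_le_ofReal hw)

end WalkLE

/-- With `x` rescaled by `A`, the Euclidean distance is at most the `L¹` distance, and at most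
`√(1 / A ^ 2 + 1)` times the `L∞` distance. -/
lemma dist_bounds {A : ℝ} (hA : 1 ≤ A) (p q : Plane) :
    dist p q ≤ |A * p 0 - A * q 0| + |p 1 - q 1| ∧
      dist p q ≤ √(1 / A ^ 2 + 1) * max |A * p 0 - A * q 0| |p 1 - q 1| := by
  have hA0 : 0 < A := by linarith
  rw [EuclideanSpace.dist_eq, Fin.sum_univ_two, Real.dist_eq, Real.dist_eq, ← mul_sub, abs_mul,
    abs_of_pos hA0]
  have h0 := abs_nonneg (p 0 - q 0)
  have h1 := abs_nonneg (p 1 - q 1)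
  generalize |p 0 - q 0| = X at *
  generalize |p 1 - q 1| = Y at *
  have hXA : X ≤ A * X := by nlinarith
  constructor
  · rw [Real.sqrt_le_left (by positivity)]
    nlinarith [mul_nonneg (h0.trans hXA) h1]
  · have hM : 0 ≤ max (A * X) Y := le_max_of_le_right h1
    rw [← Real.sqrt_sq hM, ← Real.sqrt_mul (by positivity)]
    refine Real.sqrt_le_sqrt ?_
    have e1 : X ^ 2 = 1 / A ^ 2 * (A * X) ^ 2 := by field_simp
    rw [add_mul, one_mul, e1]
    have e2 : (A * X) ^ 2 ≤ max (A * X) Y ^ 2 :=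
      pow_le_pow_left₀ (by positivity) (le_max_left _ _) 2
    have e3 : Y ^ 2 ≤ max (A * X) Y ^ 2 := pow_le_pow_left₀ h1 (le_max_right _ _) 2
    gcongr

/-- The rectangle Delaunay triangulation as a net, the `x`-coordinate being multiplied by the
aspect ratio `A`, so that the homothets of `R` are squares. -/
noncomputable def rectangleNet (R : Rectangle) (P : Finset Plane)
    (hP : ∀ p ∈ P, ∀ q ∈ P, p ≠ q → p 0 ≠ q 0 ∧ p 1 ≠ q 1) (A : ℝ) (hA : 1 ≤ A)
    (hRA : R.height = A * R.width) : SquareNet {p : Plane // p ∈ P} where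
  x p := A * (p : Plane) 0
  y p := (p : Plane) 1
  ν := √(1 / A ^ 2 + 1)
  Conn := WalkLE (rectangleDelaunay R P)
  x_inj p q h := by
    by_contra hne
    exact (hP p p.2 q q.2 (Subtype.coe_ne_coe.2 hne)).1
      (mul_left_cancel₀ (by linarith : A ≠ 0) h)
  y_inj p q h := by
    by_contra hne
    exact (hP p p.2 q q.2 (Subtype.coe_ne_coe.2 hne)).2 h
  one_le_ν := Real.one_le_sqrt.2 (le_add_of_nonneg_left (by positivity))
  refl := WalkLE.refl
  symm := WalkLE.symm
  trans := WalkLE.trans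
  mono := WalkLE.mono
  edge {p q X Y s} hs hp hq hE := by
    have hA0 : 0 < A := by linarith
    obtain ⟨h1, h2⟩ := dist_bounds hA (p : Plane) q
    suffices h : WalkLE (rectangleDelaunay R P) p q (dist (p : Plane) q) from
      ⟨h.mono h1, h.mono h2⟩
    rcases eq_or_ne p q with rfl | hne
    · exact (WalkLE.refl p).mono dist_nonneg
    have hin : ∀ v ∈ P, v ∉ (Rectangle.mk (X / A) Y (s / A) s (by positivity) hs).inner := by
      rintro v hv ⟨v1, v2, v3, v4⟩
      simp only [← add_div, div_lt_iff₀ hA0, lt_div_iff₀ hA0] at v1 v2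
      exact hE ⟨v, hv⟩ (by simpa [mul_comm] using v1) (by simpa [mul_comm] using v2) v3 v4
    have hbd : ∀ v : {p : Plane // p ∈ P}, (X ≤ A * (v : Plane) 0 ∧ A * (v : Plane) 0 ≤ X + s ∧
        Y ≤ (v : Plane) 1 ∧ (v : Plane) 1 ≤ Y + s) →
        (v : Plane) ∈ (Rectangle.mk (X / A) Y (s / A) s (by positivity) hs).boundary := by
      rintro v ⟨v1, v2, v3, v4⟩
      refine ⟨⟨?_, ?_, v3, v4⟩, hin v v.2⟩
      · rw [div_le_iff₀ hA0]; linarith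
      · rw [← add_div, le_div_iff₀ hA0]; linarith
    have hw := R.width_pos
    exact WalkLE.of_adj ⟨hne, _, ⟨s / R.height, div_pos hs R.height_pos, by
        simp only [hRA]; field_simp, by
        have := R.height_pos; field_simp⟩, hbd p hp, hbd q hq, hin⟩

theorem mainTheorem2 (R : Rectangle) (hR : R.width ≤ R.height) (P : Finset Plane)
    (hP : GeneralPosition R P) (A : ℝ) (hA : A = R.aspectRatio)
    (u v : {p : Plane // p ∈ P}) :
    (dy u v ≤ A * dx u v →
      dt R P u v ≤ ENNReal.ofReal ((A + √(A ^ 2 + 1)) * dx u v + dy u v)) ∧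
    (A * dx u v < dy u v →
      dt R P u v ≤ ENNReal.ofReal (A * dx u v + (1 + √(1 / A ^ 2 + 1)) * dy u v)) := by
  have hw := R.width_pos
  have hA' : A = R.height / R.width := by
    rw [hA, Rectangle.aspectRatio, max_eq_right hR, min_eq_left hR]
  have hA1 : 1 ≤ A := by rw [hA', one_le_div hw]; exact hR
  have hRA : R.height = A * R.width := by rw [hA']; field_simp
  have hA0 : 0 < A := by linarith
  have h := (rectangleNet R P hP.2 A hA1 hRA).conn_bound u v
  have hx : |A * (u : Plane) 0 - A * (v : Plane) 0| = A * dx u v := by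
    rw [← mul_sub, abs_mul, abs_of_pos hA0, dx]
  have hsqrt : √(A ^ 2 + 1) = A * √(1 / A ^ 2 + 1) := by
    rw [← Real.sqrt_sq hA0.le, ← Real.sqrt_mul (by positivity), Real.sqrt_sq hA0.le]
    congr 1
    field_simp
    ring
  have hb : (rectangleNet R P hP.2 A hA1 hRA).bound u v =
      A * dx u v + dy u v + √(1 / A ^ 2 + 1) * max (A * dx u v) (dy u v) := by
    rw [← hx]; rfl
  rw [hb] at h
  refine ⟨fun hle => ?_, fun hlt => ?_⟩
  · rw [max_eq_left hle] at h
    refine (h.mono (le_of_eq ?_)).dt_le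
    rw [hsqrt]; ring
  · rw [max_eq_right hlt.le] at h
    exact (h.mono (le_of_eq (by ring))).dt_le
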